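/- Let $A$, $B$ and $C$ be nontrivial finitely generated groups, each equipped with the word metric (the path metric of a Cayley graph) of a finite generating set; as usual, different finite generating sets give bilipschitz equivalent metrics. A map $f\colon X\to Y$ of metric spaces is a quasi-isometry if there are constants $L\ge 1$ and $c\ge 0$ such that $L^{-1}d(x,x')-c\le d(f(x),f(x'))\le L\,d(x,x')+c$ for all $x,x'\in X$, and every point of $Y$ is within distance $c$ of $f(X)$; two finitely generated groups are quasi-isometric if there is a quasi-isometry between them. Suppose that $A$ and $B$ are quasi-isometric, and that it is not the case that $C$ and at least one of $A$, $B$ have order $2$. Then the free products $A*C$ and $B*C$ are quasi-isometric. -/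

import Mathlib

/-- A map `f` between the vertex sets of two connected graphs is a quasi-isometry for the path
metrics (every edge has length `1`) if there are constants `L ≥ 1` and `c ≥ 0` such that
`L⁻¹ d(x, y) - c ≤ d(f x, f y) ≤ L d(x, y) + c` for all `x, y`, and every vertex of the target is
within distance `c` of the image of `f`. -/
def IsGraphQuasiIsometry {X Y : Type*} (Γ : SimpleGraph X) (Δ : SimpleGraph Y) (f : X → Y) :
    Prop :=
  ∃ L c : ℝ, 1 ≤ L ∧ 0 ≤ c ∧
    (∀ x y : X, L⁻¹ * (Γ.dist x y : ℝ) - c ≤ (Δ.dist (f x) (f y) : ℝ) ∧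
      (Δ.dist (f x) (f y) : ℝ) ≤ L * (Γ.dist x y : ℝ) + c) ∧
    ∀ y : Y, ∃ x : X, (Δ.dist (f x) y : ℝ) ≤ c

/-- The Cayley graph of a group with respect to a generating set is connected, so that its path
metric `SimpleGraph.dist` is the word metric. -/
theorem mulCayley_connected_of_closure_eq_top {G : Type*} [Group G] (S : Set G)
    (hS : Subgroup.closure S = ⊤) : (SimpleGraph.mulCayley S).Connected := by
  have key : ∀ x ∈ Subgroup.closure S, ∀ g : G, (SimpleGraph.mulCayley S).Reachable g (g * x) := by
    intro x hx
    induction hx using Subgroup.closure_induction with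
    | mem x hx =>
      intro g
      by_cases h : g = g * x
      · rw [← h]
      · exact SimpleGraph.Adj.reachable
          ((SimpleGraph.mulCayley_adj' S g (g * x)).2 ⟨h, x, hx, Or.inl rfl⟩)
    | one => intro g; rw [mul_one]
    | mul x y _ _ hx hy =>
      intro g
      have h := (hx g).trans (hy (g * x))
      rwa [mul_assoc] at h
    | inv x _ hx =>
      intro g
      have h := (hx (g * x⁻¹)).symm
      rwa [inv_mul_cancel_right] at h
  refine (SimpleGraph.connected_iff _).2 ⟨fun u v => ?_, ⟨1⟩⟩
  have h := key (u⁻¹ * v) (by rw [hS]; trivial) u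
  rwa [mul_inv_cancel_left] at h

/-- Two finitely generated groups are quasi-isometric if there is a quasi-isometry between their
Cayley graphs with respect to some finite generating sets. (Different finite generating sets give
bilipschitz equivalent metrics, so the choice of the generating sets is immaterial.) -/
def GroupsQuasiIsometric (G H : Type*) [Group G] [Group H] : Prop :=
  ∃ (S : Set G) (T : Set H), S.Finite ∧ Subgroup.closure S = ⊤ ∧
    T.Finite ∧ Subgroup.closure T = ⊤ ∧
    ∃ f : G → H, IsGraphQuasiIsometry (SimpleGraph.mulCayley S) (SimpleGraph.mulCayley T) f

/-! By normal forms, `A * C` is a tree of spaces in which copies of `A` and `C` alternate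
(`bilipschitzEquivalent_mulCayley_coprod`). A quasi-isometry from `A` to `B` need not be close to a
bijection, but it gives a relation `Y` between the nontrivial elements whose two projections are
onto with fibres of bounded size, and along which the two metrics control each other
(`exists_relation_of_isGraphQuasiIsometry`). It is therefore enough that replacing the nontrivial
elements of `A` by such a bounded-to-one cover `Y` changes the tree of spaces only by a bilipschitz
bijection (`Splitting.bilipschitzEquivalent_coverGraph`): the tree over `Y` then compares with both
free products.

To pass from `Y` to its quotient, the branches at the points of one fibre must be merged into one
branch. This is a Hilbert hotel. Fix two slots `u ≠ v` of a branch. The first branch stays, the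
others are merged into slot `u`, and the branches formerly at `u` are merged with those at `v`. The
recursion goes on down the tree, but if fibres have at most `N` points, it never merges more than `2
* N` branches at once, so edges are stretched by a bounded amount. Two slots exist unless `C` and
the other factor both have order two, which is the excluded infinite dihedral case. -/

namespace FreeProductTree

/-! ### Maps bounded on edges, and bilipschitz bijections of graphs. -/

section Lipschitz

variable {X Y Z : Type*}

/-- A map of graphs sending adjacent vertices to vertices at distance at most `M`. -/
def EdgeLipschitz (G : SimpleGraph X) (H : SimpleGraph Y) (f : X → Y) (M : ℕ) : Prop :=
  ∀ ⦃x y⦄, G.Adj x y → H.edist (f x) (f y) ≤ M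

theorem EdgeLipschitz.edist_le {G : SimpleGraph X} {H : SimpleGraph Y} {f : X → Y} {M n : ℕ}
    (hf : EdgeLipschitz G H f M) {x y : X} (h : G.edist x y ≤ n) :
    H.edist (f x) (f y) ≤ (M * n : ℕ) := by
  have key : ∀ {x y : X} (w : G.Walk x y), H.edist (f x) (f y) ≤ (M * w.length : ℕ) := by
    intro x y w
    induction w with
    | nil => simp
    | cons h w ih =>
      refine (H.edist_triangle).trans ((add_le_add (hf h) ih).trans ?_)
      rw [SimpleGraph.Walk.length_cons]
      exact_mod_cast (by ring_nf; rfl)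
  have hne : G.edist x y ≠ ⊤ := ne_top_of_le_ne_top (ENat.natCast_ne_top n) h
  obtain ⟨w, hw⟩ := SimpleGraph.exists_walk_of_edist_ne_top hne
  refine (key w).trans ?_
  rw [← hw] at h
  have h' : w.length ≤ n := by exact_mod_cast h
  exact_mod_cast Nat.mul_le_mul_left M h'

theorem EdgeLipschitz.comp {G : SimpleGraph X} {H : SimpleGraph Y} {K : SimpleGraph Z}
    {f : X → Y} {g : Y → Z} {M N : ℕ} (hg : EdgeLipschitz H K g N) (hf : EdgeLipschitz G H f M) :
    EdgeLipschitz G K (g ∘ f) (N * M) :=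
  fun _ _ h => hg.edist_le (hf h)

/-- With constant one the estimate also holds at infinite distance, so later uses need no
connectedness. -/
theorem EdgeLipschitz.edist_le_edist {G : SimpleGraph X} {H : SimpleGraph Y} {f : X → Y}
    (hf : EdgeLipschitz G H f 1) (x y : X) : H.edist (f x) (f y) ≤ G.edist x y := by
  rcases eq_or_ne (G.edist x y) ⊤ with h | h
  · rw [h]; exact le_top
  · obtain ⟨n, hn⟩ := ENat.ne_top_iff_exists.1 h
    rw [← hn]
    simpa using hf.edist_le hn.symm.le

theorem edist_fromRel_le_one {r : X → X → Prop} {x y : X} (h : r x y) :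
    (SimpleGraph.fromRel r).edist x y ≤ 1 := by
  by_cases hxy : x = y
  · subst hxy; simp
  · exact (SimpleGraph.edist_eq_one_iff_adj.2 (by simp [hxy, h])).le

theorem edgeLipschitz_fromRel {r : X → X → Prop} {H : SimpleGraph Y} {f : X → Y} {M : ℕ}
    (h : ∀ x y, r x y → H.edist (f x) (f y) ≤ M) :
    EdgeLipschitz (SimpleGraph.fromRel r) H f M := by
  rintro x y ⟨-, hxy | hxy⟩
  · exact h x y hxy
  · rw [SimpleGraph.edist_comm]; exact h y x hxy

/-- Two graphs are bilipschitz equivalent if some bijection of the vertices is bounded on edges in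
both directions. -/
def BilipschitzEquivalent (G : SimpleGraph X) (H : SimpleGraph Y) : Prop :=
  ∃ (e : X ≃ Y) (M : ℕ), EdgeLipschitz G H e M ∧ EdgeLipschitz H G e.symm M

theorem EdgeLipschitz.mono {G : SimpleGraph X} {H : SimpleGraph Y} {f : X → Y} {M N : ℕ}
    (hf : EdgeLipschitz G H f M) (h : M ≤ N) : EdgeLipschitz G H f N :=
  fun _ _ hxy => (hf hxy).trans (by exact_mod_cast h)

theorem BilipschitzEquivalent.symm {G : SimpleGraph X} {H : SimpleGraph Y}
    (h : BilipschitzEquivalent G H) : BilipschitzEquivalent H G := by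
  obtain ⟨e, M, h₁, h₂⟩ := h
  exact ⟨e.symm, M, h₂, h₁⟩

theorem BilipschitzEquivalent.trans {G : SimpleGraph X} {H : SimpleGraph Y} {K : SimpleGraph Z}
    (h : BilipschitzEquivalent G H) (h' : BilipschitzEquivalent H K) :
    BilipschitzEquivalent G K := by
  obtain ⟨e, M, h₁, h₂⟩ := h
  obtain ⟨e', M', h₁', h₂'⟩ := h'
  exact ⟨e.trans e', M' * M, h₁'.comp h₁, (h₂.comp h₂').mono (by rw [mul_comm])⟩

theorem EdgeLipschitz.dist_le {G : SimpleGraph X} {H : SimpleGraph Y} {f : X → Y} {M : ℕ}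
    (hf : EdgeLipschitz G H f M) (hG : G.Connected) (x y : X) :
    H.dist (f x) (f y) ≤ M * G.dist x y :=
  ENat.toNat_le_of_le_natCast (hf.edist_le (hG x y).coe_dist_eq_edist.symm.le)

theorem BilipschitzEquivalent.exists_isGraphQuasiIsometry {G : SimpleGraph X} {H : SimpleGraph Y}
    (hG : G.Connected) (hH : H.Connected) (h : BilipschitzEquivalent G H) :
    ∃ f : X → Y, IsGraphQuasiIsometry G H f := by
  obtain ⟨e, M, h₁, h₂⟩ := h
  -- `M` may be zero, while the multiplicative constant must be at least one.
  refine ⟨e, M + 1, 0, by simp, le_rfl, fun x y => ⟨?_, ?_⟩, fun y => ⟨e.symm y, by simp⟩⟩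
  · have := h₂.dist_le hH (e x) (e y)
    simp only [Equiv.symm_apply_apply] at this
    have h' : (G.dist x y : ℝ) ≤ M * H.dist (e x) (e y) := by exact_mod_cast this
    rw [sub_zero, inv_mul_le_iff₀ (by positivity)]
    nlinarith [(Nat.cast_nonneg (H.dist (e x) (e y)) : (0 : ℝ) ≤ _)]
  · have h' : (H.dist (e x) (e y) : ℝ) ≤ M * G.dist x y := by exact_mod_cast h₁.dist_le hG x y
    nlinarith [(Nat.cast_nonneg (G.dist x y) : (0 : ℝ) ≤ _)]

end Lipschitz

/-! ### Trees of spaces. -/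

section Tree

variable {α γ : Type*}

/-- The vertices of a rooted tree of spaces: a copy of `Option γ`, with a copy of `Option α`
attached at each of its points other than `none`, with a branch attached at each point of the
latter other than `none`, and so on. -/
abbrev Branch (α γ : Type*) := List (γ × α) × Option γ

namespace Branch

/-- The root of a branch. -/
def root : Branch α γ := ([], none)

/-- The inclusion of the sub-branch at `x`. -/
def cons (x : γ × α) (t : Branch α γ) : Branch α γ := (x :: t.1, t.2)

/-- The inclusion of the copy of `Option α` attached at the point `c` of the root space. -/
def side (c : γ) : Option α → Branch α γ
  | none => ([], some c)
  | some a => cons (c, a) root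

end Branch

/-- The edges of a branch. -/
inductive BranchRel (Gα : SimpleGraph (Option α)) (Gγ : SimpleGraph (Option γ)) :
    Branch α γ → Branch α γ → Prop
  | base {c c'} : Gγ.Adj c c' → BranchRel Gα Gγ ([], c) ([], c')
  | side (c) {x x'} : Gα.Adj x x' → BranchRel Gα Gγ (Branch.side c x) (Branch.side c x')
  | cons (x) {t₁ t₂} : BranchRel Gα Gγ t₁ t₂ → BranchRel Gα Gγ (Branch.cons x t₁) (Branch.cons x t₂)

/-- The edges of the tree of spaces with a copy of `Option α` at the centre. -/
inductive TreeRel (Gα : SimpleGraph (Option α)) (Gγ : SimpleGraph (Option γ)) :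
    Option α × Branch α γ → Option α × Branch α γ → Prop
  | centre {x x'} : Gα.Adj x x' → TreeRel Gα Gγ (x, Branch.root) (x', Branch.root)
  | branch (x) {t₁ t₂} : BranchRel Gα Gγ t₁ t₂ → TreeRel Gα Gγ (x, t₁) (x, t₂)

/-- The graph structure of a branch. -/
def branchGraph (Gα : SimpleGraph (Option α)) (Gγ : SimpleGraph (Option γ)) :
    SimpleGraph (Branch α γ) :=
  SimpleGraph.fromRel (BranchRel Gα Gγ)

/-- The tree of spaces in which copies of `Option α` and `Option γ` alternate. -/
def treeGraph (Gα : SimpleGraph (Option α)) (Gγ : SimpleGraph (Option γ)) :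
    SimpleGraph (Option α × Branch α γ) :=
  SimpleGraph.fromRel (TreeRel Gα Gγ)

variable {Gα : SimpleGraph (Option α)} {Gγ : SimpleGraph (Option γ)}

theorem edgeLipschitz_cons (x : γ × α) :
    EdgeLipschitz (branchGraph Gα Gγ) (branchGraph Gα Gγ) (Branch.cons x) 1 :=
  edgeLipschitz_fromRel fun _ _ h => edist_fromRel_le_one (.cons x h)

theorem edgeLipschitz_side (c : γ) :
    EdgeLipschitz Gα (branchGraph Gα Gγ) (Branch.side c) 1 :=
  fun _ _ h => edist_fromRel_le_one (.side c h)

theorem edgeLipschitz_base :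
    EdgeLipschitz Gγ (branchGraph Gα Gγ) (fun c => (([], c) : Branch α γ)) 1 :=
  fun _ _ h => edist_fromRel_le_one (.base h)

theorem edgeLipschitz_centre :
    EdgeLipschitz Gα (treeGraph Gα Gγ) (fun x => (x, Branch.root)) 1 :=
  fun _ _ h => edist_fromRel_le_one (.centre h)

theorem edgeLipschitz_branch (x : Option α) :
    EdgeLipschitz (branchGraph Gα Gγ) (treeGraph Gα Gγ) (fun t => (x, t)) 1 :=
  edgeLipschitz_fromRel fun _ _ h => edist_fromRel_le_one (.branch x h)

theorem edgeLipschitz_branchGraph_id {Gα' : SimpleGraph (Option α)} {M : ℕ}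
    (h : EdgeLipschitz Gα Gα' id M) (hM : 1 ≤ M) :
    EdgeLipschitz (branchGraph Gα Gγ) (branchGraph Gα' Gγ) id M := by
  refine edgeLipschitz_fromRel fun t t' ht => ?_
  induction ht with
  | base h' => exact (edist_fromRel_le_one (.base h')).trans (by exact_mod_cast hM)
  | side c h' => exact ((edgeLipschitz_side c).edist_le_edist _ _).trans (h h')
  | cons x _ ih => exact ((edgeLipschitz_cons x).edist_le_edist _ _).trans ih

theorem edgeLipschitz_treeGraph_id {Gα' : SimpleGraph (Option α)} {M : ℕ}
    (h : EdgeLipschitz Gα Gα' id M) (hM : 1 ≤ M) :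
    EdgeLipschitz (treeGraph Gα Gγ) (treeGraph Gα' Gγ) id M := by
  refine edgeLipschitz_fromRel fun t t' ht => ?_
  induction ht with
  | centre h' => exact (edgeLipschitz_centre.edist_le_edist _ _).trans (h h')
  | branch x h' =>
    refine ((edgeLipschitz_branch x).edist_le_edist _ _).trans ?_
    simpa using (edgeLipschitz_branchGraph_id h hM).edist_le (edist_fromRel_le_one h')

theorem edist_root_cons_le (hα : Gα.Connected) (hγ : Gγ.Connected) (x : γ × α) :
    ∃ R : ℕ, (branchGraph Gα Gγ).edist Branch.root (Branch.cons x Branch.root) ≤ R := by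
  refine ⟨Gγ.dist none (some x.1) + Gα.dist none (some x.2), ?_⟩
  refine ((branchGraph Gα Gγ).edist_triangle (v := ([], some x.1))).trans ?_
  push_cast
  rw [(hα _ _).coe_dist_eq_edist, (hγ _ _).coe_dist_eq_edist]
  exact add_le_add (edgeLipschitz_base.edist_le_edist _ _)
    ((edgeLipschitz_side x.1).edist_le_edist none (some x.2))

end Tree

/-! ### Merging branches: the bijection on words. -/

section Transducer

variable {α γ Y : Type*}

/-- A surjection `p : Y → α` with finite fibres, together with enumerations of the fibres. -/
structure Splitting (Y α : Type*) where
  /-- the projection -/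
  p : Y → α
  /-- the position of a point in its fibre -/
  idx : Y → ℕ
  /-- the cardinality of a fibre -/
  n : α → ℕ
  /-- the point of a fibre at a given position -/
  pt : α → ℕ → Y
  p_pt : ∀ a j, p (pt a j) = a
  idx_pt : ∀ a j, j < n a → idx (pt a j) = j
  idx_lt : ∀ y, idx y < n (p y)
  pt_idx : ∀ y, pt (p y) (idx y) = y

namespace Splitting

variable (σ : Splitting Y α)

theorem n_pos (a : α) : 0 < σ.n a := by
  have := σ.idx_lt (σ.pt a 0)
  rw [σ.p_pt] at this
  exact lt_of_le_of_lt (Nat.zero_le _) this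

open Classical in
/-- `merge k i s` is the new position of the word `s` in the `i`-th of `k` branches which are to be
merged into a single branch. The zeroth branch stays where it is, the others go to the slot `u` of
it, and the branches attached to `u` and to `v` go to `v`. -/
noncomputable def merge (u v : γ × α) : ℕ → ℕ → List (γ × Y) → List (γ × α)
  | k, i + 1, s => u :: merge u v (k - 1) i s
  | _, 0, [] => []
  | k, 0, z :: s =>
    -- A single branch (`k = 1`) needs no room, so nothing is displaced. Otherwise, at `v`, the
    -- branches native to `v` take the positions below `σ.n v.2` and those displaced from `u` follow
    -- them.
    if 1 < k ∧ (z.1, σ.p z.2) = u then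
      v :: merge u v (σ.n u.2 + σ.n v.2) (σ.n v.2 + σ.idx z.2) s
    else if 1 < k ∧ (z.1, σ.p z.2) = v then
      v :: merge u v (σ.n u.2 + σ.n v.2) (σ.idx z.2) s
    else (z.1, σ.p z.2) :: merge u v (σ.n (σ.p z.2)) (σ.idx z.2) s
  termination_by _ i s => (s.length, i)

open Classical in
/-- The inverse of `Splitting.merge`. -/
noncomputable def split (u v : γ × α) : ℕ → List (γ × α) → ℕ × List (γ × Y)
  | _, [] => (0, [])
  | k, x :: w =>
    -- The position counts initial letters `u` as long as `1 < k`. Which point of a fibre a letter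
    -- lifts to is thus decided by the word that follows it.
    if 1 < k ∧ x = u then ((split u v (k - 1) w).1 + 1, (split u v (k - 1) w).2)
    else if 1 < k ∧ x = v then
      (0, (if (split u v (σ.n u.2 + σ.n v.2) w).1 < σ.n v.2
        then (v.1, σ.pt v.2 (split u v (σ.n u.2 + σ.n v.2) w).1)
        else (u.1, σ.pt u.2 ((split u v (σ.n u.2 + σ.n v.2) w).1 - σ.n v.2))) ::
          (split u v (σ.n u.2 + σ.n v.2) w).2)
    else (0, (x.1, σ.pt x.2 (split u v (σ.n x.2) w).1) :: (split u v (σ.n x.2) w).2)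

variable {u v : γ × α}

theorem split_fst_lt (w : List (γ × α)) : ∀ k, 0 < k → (σ.split u v k w).1 < k := by
  induction w with
  | nil => intro k hk; simpa [split] using hk
  | cons x w ih =>
    intro k hk
    rw [split]
    split_ifs with h h'
    · have := ih (k - 1) (by omega)
      simp only
      omega
    all_goals exact hk

theorem merge_split (huv : u ≠ v) (w : List (γ × α)) :
    ∀ k, 0 < k → σ.merge u v k (σ.split u v k w).1 (σ.split u v k w).2 = w := by
  induction w with
  | nil => intro k hk; simp [split, merge]
  | cons x w ih =>
    intro k hk
    have hpos := σ.n_pos u.2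
    rw [split]
    split_ifs with h h' h''
    · simp only
      rw [merge, ih _ (by omega), h.2]
    · have := ih (σ.n u.2 + σ.n v.2) (by omega)
      simp only
      rw [merge]
      rw [if_neg (fun h => huv (h.2.symm.trans (by simp only [σ.p_pt]))),
        if_pos ⟨h'.1, by simp only [σ.p_pt]⟩, σ.idx_pt _ _ h'', this, h'.2]
    · have := ih (σ.n u.2 + σ.n v.2) (by omega)
      have hlt := σ.split_fst_lt (u := u) (v := v) w (σ.n u.2 + σ.n v.2) (by omega)
      simp only
      rw [merge]
      rw [if_pos ⟨h'.1, by simp only [σ.p_pt]⟩, σ.idx_pt _ _ (by omega),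
        Nat.add_sub_of_le (by omega), this, h'.2]
    · have := ih (σ.n x.2) (σ.n_pos _)
      have hlt := σ.split_fst_lt (u := u) (v := v) w (σ.n x.2) (σ.n_pos _)
      simp only
      rw [merge]
      rw [if_neg (by simpa only [σ.p_pt] using h), if_neg (by simpa only [σ.p_pt] using h')]
      simp only [σ.p_pt, σ.idx_pt _ _ hlt, this]

/-- The bound `i < k` ensures `1 < k` whenever a positive position makes `merge` write a letter `u`,
so that `split` reads that letter as a position and not as a point. -/
theorem split_merge (huv : u ≠ v) (k i : ℕ) (s : List (γ × Y)) (hi : i < k) :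
    σ.split u v k (σ.merge u v k i s) = (i, s) := by
  induction k, i, s using merge.induct (σ := σ) (u := u) (v := v) with
  | case1 k i s ih =>
    rw [merge, split, if_pos ⟨by omega, rfl⟩, ih (by omega)]
  | case2 k => rw [merge, split]
  | case3 k z s h ih =>
    have := σ.idx_lt z.2
    have hp : σ.p z.2 = u.2 := congrArg Prod.snd h.2
    have h1 : z.1 = u.1 := congrArg Prod.fst h.2
    rw [merge, if_pos h, split, if_neg (fun h => huv h.2.symm), if_pos ⟨h.1, rfl⟩,
      ih (by rw [hp] at this; omega)]
    simp only [add_lt_iff_neg_left, not_lt_zero, if_false, Nat.add_sub_cancel_left]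
    rw [← hp, ← h1, σ.pt_idx]
  | case4 k z s h h' ih =>
    have := σ.idx_lt z.2
    have hp : σ.p z.2 = v.2 := congrArg Prod.snd h'.2
    have h1 : z.1 = v.1 := congrArg Prod.fst h'.2
    rw [hp] at this
    rw [merge, if_neg h, if_pos h', split, if_neg (fun h => huv h.2.symm), if_pos ⟨h'.1, rfl⟩,
      ih (by omega)]
    simp only [this, if_true]
    rw [← hp, ← h1, σ.pt_idx]
  | case5 k z s h h' ih =>
    rw [merge, if_neg h, if_neg h', split, if_neg h, if_neg h', ih (σ.idx_lt _)]
    simp only [σ.pt_idx]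

/-- The action of `Splitting.merge` on the vertices of a branch. -/
noncomputable def mergeBranch (u v : γ × α) (k i : ℕ) (t : Branch Y γ) : Branch α γ :=
  (σ.merge u v k i t.1, t.2)

/-- The action of `Splitting.split` on the vertices of a branch. -/
noncomputable def splitBranch (u v : γ × α) (k : ℕ) (t : Branch α γ) : ℕ × Branch Y γ :=
  ((σ.split u v k t.1).1, (σ.split u v k t.1).2, t.2)

theorem mergeBranch_succ (k i : ℕ) (t : Branch Y γ) :
    σ.mergeBranch u v k (i + 1) t = Branch.cons u (σ.mergeBranch u v (k - 1) i t) := by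
  rw [mergeBranch, merge]; rfl

theorem mergeBranch_nil (k : ℕ) (c : Option γ) : σ.mergeBranch u v k 0 ([], c) = ([], c) := by
  rw [mergeBranch, merge]

theorem splitBranch_nil (k : ℕ) (c : Option γ) : σ.splitBranch u v k ([], c) = (0, [], c) := by
  rw [splitBranch, split]

/-- The bijection of trees of spaces given by merging the branches attached to the points of the
fibres of the projection. -/
noncomputable def treeEquiv (huv : u ≠ v) : Option Y × Branch Y γ ≃ Option α × Branch α γ where
  toFun
    | (none, t) => (none, σ.mergeBranch u v 1 0 t)
    | (some y, t) => (some (σ.p y), σ.mergeBranch u v (σ.n (σ.p y)) (σ.idx y) t)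
  invFun
    | (none, t) => (none, (σ.splitBranch u v 1 t).2)
    | (some a, t) =>
      (some (σ.pt a (σ.splitBranch u v (σ.n a) t).1), (σ.splitBranch u v (σ.n a) t).2)
  left_inv := by
    rintro ⟨_ | y, s, c⟩
    · simp [mergeBranch, splitBranch, σ.split_merge huv]
    · simp [mergeBranch, splitBranch, σ.split_merge huv _ _ _ (σ.idx_lt y), σ.pt_idx]
  right_inv := by
    rintro ⟨_ | a, w, c⟩
    · have h := σ.merge_split huv w 1 one_pos
      have h' := σ.split_fst_lt (u := u) (v := v) w 1 one_pos
      rw [Nat.lt_one_iff] at h'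
      rw [h'] at h
      simp [mergeBranch, splitBranch, h]
    · simp [mergeBranch, splitBranch, σ.merge_split huv w _ (σ.n_pos a), σ.p_pt,
        σ.idx_pt _ _ (σ.split_fst_lt (u := u) (v := v) w (σ.n a) (σ.n_pos a))]

end Splitting

end Transducer

/-! ### Bilipschitz bounds for the merging bijection. -/

section Cover

variable {α γ Y : Type*}

/-- The graph on `Option Y` in which points are adjacent if their images in `Option α` are equal or
adjacent. -/
def coverGraph (p : Y → α) (Gα : SimpleGraph (Option α)) : SimpleGraph (Option Y) :=
  SimpleGraph.fromRel fun y y' => Gα.edist (y.map p) (y'.map p) ≤ 1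

variable {Gα : SimpleGraph (Option α)} {Gγ : SimpleGraph (Option γ)}

theorem edgeLipschitz_map (p : Y → α) : EdgeLipschitz (coverGraph p Gα) Gα (Option.map p) 1 :=
  edgeLipschitz_fromRel fun _ _ h => h

namespace Splitting

variable (σ : Splitting Y α)

theorem map_p_map_pt (x : Option α) : (x.map (σ.pt · 0)).map σ.p = x := by
  cases x <;> simp [σ.p_pt]

theorem edgeLipschitz_map_pt :
    EdgeLipschitz Gα (coverGraph σ.p Gα) (Option.map (σ.pt · 0)) 1 := fun x x' h =>
  edist_fromRel_le_one (by
    rw [σ.map_p_map_pt, σ.map_p_map_pt]; exact (SimpleGraph.edist_eq_one_iff_adj.2 h).le)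

theorem edist_coverGraph_le_one {y y' : Option Y} (h : y.map σ.p = y'.map σ.p) :
    (coverGraph σ.p Gα).edist y y' ≤ 1 :=
  edist_fromRel_le_one (by rw [h]; simp)

theorem edist_root_cons_coverGraph_le (hα : Gα.Connected) (hγ : Gγ.Connected) (x : γ × α) :
    ∃ R : ℕ, ∀ y, σ.p y = x.2 → (branchGraph (coverGraph σ.p Gα) Gγ).edist Branch.root
      (Branch.cons (x.1, y) Branch.root) ≤ R := by
  refine ⟨Gγ.dist none (some x.1) + (Gα.dist none (some x.2) + 1), fun y hy => ?_⟩
  refine (SimpleGraph.edist_triangle (v := ([], some x.1))).trans ?_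
  push_cast
  rw [(hα _ _).coe_dist_eq_edist, (hγ _ _).coe_dist_eq_edist]
  refine add_le_add (edgeLipschitz_base.edist_le_edist _ _)
    (((edgeLipschitz_side x.1).edist_le_edist none (some y)).trans ?_)
  exact (SimpleGraph.edist_triangle (v := (some x.2).map (σ.pt · 0))).trans
    (add_le_add (σ.edgeLipschitz_map_pt.edist_le_edist none (some x.2))
    (σ.edist_coverGraph_le_one (by simp [σ.p_pt, hy])))

variable {u v : γ × α}

section Merge

variable {R N : ℕ}

/-- The branch at position `i` is pushed down through `i` successive slots `u`, each costing `R`. -/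
theorem edist_root_mergeBranch_le
    (hu : (branchGraph Gα Gγ).edist Branch.root (Branch.cons u Branch.root) ≤ R) (i : ℕ) :
    ∀ k, (branchGraph Gα Gγ).edist Branch.root (σ.mergeBranch u v k i Branch.root) ≤
      (i * R : ℕ) := by
  induction i with
  | zero => intro k; simp [Branch.root, mergeBranch_nil]
  | succ i ih =>
    intro k
    rw [mergeBranch_succ]
    refine (SimpleGraph.edist_triangle (v := Branch.cons u Branch.root)).trans ?_
    refine (add_le_add hu (((edgeLipschitz_cons u).edist_le_edist _ _).trans (ih _))).trans ?_
    exact_mod_cast (by ring_nf; rfl)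

/-- After one letter the state of the merge does not depend on the rest of the word, so a prefix
common to both ends of an edge can be peeled off. The letter written differs from the projected one
only when `u` becomes `v`, at a cost of `2 * R` through the root. The new position is at most `2 *
N` because at most two fibres are combined. -/
theorem mergeBranch_cons (hN : ∀ a, σ.n a ≤ N)
    (hu : (branchGraph Gα Gγ).edist Branch.root (Branch.cons u Branch.root) ≤ R)
    (hv : (branchGraph Gα Gγ).edist Branch.root (Branch.cons v Branch.root) ≤ R)
    (k : ℕ) (c : γ) (y : Y) :
    ∃ (x : γ × α) (k' i : ℕ), i ≤ 2 * N ∧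
      (branchGraph Gα Gγ).edist (Branch.cons (c, σ.p y) Branch.root)
        (Branch.cons x Branch.root) ≤ (2 * R : ℕ) ∧
      ∀ t, σ.mergeBranch u v k 0 (Branch.cons (c, y) t) =
        Branch.cons x (σ.mergeBranch u v k' i t) := by
  have h₁ := hN v.2
  have h₂ := (σ.idx_lt y).trans_le (hN _)
  by_cases h : 1 < k ∧ (c, σ.p y) = u
  · refine ⟨v, σ.n u.2 + σ.n v.2, σ.n v.2 + σ.idx y, by omega, ?_, fun t => ?_⟩
    · rw [h.2, two_mul]
      refine (SimpleGraph.edist_triangle (v := Branch.root)).trans ?_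
      rw [SimpleGraph.edist_comm]
      exact add_le_add hu hv
    · rw [mergeBranch, Branch.cons, merge]
      simp only [if_pos h]
      rfl
  by_cases h' : 1 < k ∧ (c, σ.p y) = v
  · refine ⟨v, σ.n u.2 + σ.n v.2, σ.idx y, by omega, ?_, fun t => ?_⟩
    · rw [h'.2]; simp
    · rw [mergeBranch, Branch.cons, merge]
      simp only [if_neg h, if_pos h']
      rfl
  · refine ⟨(c, σ.p y), σ.n (σ.p y), σ.idx y, by omega, ?_, fun t => ?_⟩
    · exact (SimpleGraph.edist_self).trans_le (by simp)
    · rw [mergeBranch, Branch.cons, merge]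
      simp only [if_neg h, if_neg h']
      rfl

theorem edist_mergeBranch_le_zero (t t' : Branch Y γ) (i : ℕ) :
    ∀ k, (branchGraph Gα Gγ).edist (σ.mergeBranch u v k i t) (σ.mergeBranch u v k i t') ≤
      (branchGraph Gα Gγ).edist (σ.mergeBranch u v (k - i) 0 t)
        (σ.mergeBranch u v (k - i) 0 t') := by
  induction i with
  | zero => intro k; rfl
  | succ i ih =>
    intro k
    rw [mergeBranch_succ, mergeBranch_succ, Nat.add_comm i, ← Nat.sub_sub]
    exact ((edgeLipschitz_cons u).edist_le_edist _ _).trans (ih _)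

/-- The change of letter costs `2 * R`, and sinking through at most `2 * N` slots `u` costs `2 * N *
R`. -/
theorem edist_side_mergeBranch_le (hN : ∀ a, σ.n a ≤ N)
    (hu : (branchGraph Gα Gγ).edist Branch.root (Branch.cons u Branch.root) ≤ R)
    (hv : (branchGraph Gα Gγ).edist Branch.root (Branch.cons v Branch.root) ≤ R)
    (k : ℕ) (c : γ) (y : Option Y) :
    (branchGraph Gα Gγ).edist (Branch.side c (y.map σ.p))
      (σ.mergeBranch u v k 0 (Branch.side c y)) ≤ (2 * R + 2 * N * R : ℕ) := by
  cases y with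
  | none => simp [Branch.side, mergeBranch_nil]
  | some y =>
    obtain ⟨x, k', i, hi, hx, ht⟩ := σ.mergeBranch_cons hN hu hv k c y
    simp only [Option.map_some, Branch.side]
    rw [ht]
    refine (SimpleGraph.edist_triangle (v := Branch.cons x Branch.root)).trans ?_
    push_cast
    refine add_le_add (by exact_mod_cast hx) (((edgeLipschitz_cons x).edist_le_edist _ _).trans
      ((σ.edist_root_mergeBranch_le hu i k').trans ?_))
    exact_mod_cast Nat.mul_le_mul_right R hi

theorem edist_mergeBranch_le (hN : ∀ a, σ.n a ≤ N)
    (hu : (branchGraph Gα Gγ).edist Branch.root (Branch.cons u Branch.root) ≤ R)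
    (hv : (branchGraph Gα Gγ).edist Branch.root (Branch.cons v Branch.root) ≤ R)
    {t t' : Branch Y γ} (h : BranchRel (coverGraph σ.p Gα) Gγ t t') :
    ∀ k i, (branchGraph Gα Gγ).edist (σ.mergeBranch u v k i t) (σ.mergeBranch u v k i t') ≤
      ((2 * R + 2 * N * R) + 1 + (2 * R + 2 * N * R) : ℕ) := by
  suffices H : ∀ k, (branchGraph Gα Gγ).edist (σ.mergeBranch u v k 0 t)
      (σ.mergeBranch u v k 0 t') ≤ ((2 * R + 2 * N * R) + 1 + (2 * R + 2 * N * R) : ℕ) from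
    fun k i => (σ.edist_mergeBranch_le_zero t t' i k).trans (H _)
  induction h with
  | base h =>
    intro k
    rw [mergeBranch_nil, mergeBranch_nil]
    exact (edist_fromRel_le_one (.base h)).trans (by exact_mod_cast (by omega))
  | @side c x x' h =>
    intro k
    refine (SimpleGraph.edist_triangle (v := Branch.side c (x'.map σ.p))).trans ?_
    rw [Nat.cast_add]
    refine add_le_add ((SimpleGraph.edist_triangle (v := Branch.side c (x.map σ.p))).trans ?_)
      (σ.edist_side_mergeBranch_le hN hu hv k c x')
    rw [Nat.cast_add, SimpleGraph.edist_comm]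
    exact add_le_add (σ.edist_side_mergeBranch_le hN hu hv k c x)
      (((edgeLipschitz_side c).edist_le_edist _ _).trans (edgeLipschitz_map σ.p h))
  | cons x _ ih =>
    intro k
    obtain ⟨x', k', i, -, -, ht⟩ := σ.mergeBranch_cons hN hu hv k x.1 x.2
    rw [ht, ht]
    exact ((edgeLipschitz_cons x').edist_le_edist _ _).trans
      ((σ.edist_mergeBranch_le_zero _ _ i k').trans (ih _))

theorem edgeLipschitz_treeEquiv (huv : u ≠ v) (hN : ∀ a, σ.n a ≤ N)
    (hu : (branchGraph Gα Gγ).edist Branch.root (Branch.cons u Branch.root) ≤ R)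
    (hv : (branchGraph Gα Gγ).edist Branch.root (Branch.cons v Branch.root) ≤ R) :
    EdgeLipschitz (treeGraph (coverGraph σ.p Gα) Gγ) (treeGraph Gα Gγ) (σ.treeEquiv huv)
      ((2 * R + 2 * N * R) + 1 + (2 * R + 2 * N * R)) := by
  have key : ∀ x : Option Y, (treeGraph Gα Gγ).edist (x.map σ.p, Branch.root)
      (σ.treeEquiv huv (x, Branch.root)) ≤ (2 * R + 2 * N * R : ℕ) := by
    rintro (_ | y)
    · simp [treeEquiv, Branch.root, mergeBranch_nil]
    · refine ((edgeLipschitz_branch _).edist_le_edist _ _).trans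
        ((σ.edist_root_mergeBranch_le hu _ _).trans ?_)
      have := (σ.idx_lt y).trans_le (hN _)
      exact_mod_cast by nlinarith
  refine edgeLipschitz_fromRel fun z z' h => ?_
  induction h with
  | @centre x x' h =>
    refine (SimpleGraph.edist_triangle (v := (x'.map σ.p, Branch.root))).trans ?_
    rw [Nat.cast_add]
    refine add_le_add ((SimpleGraph.edist_triangle (v := (x.map σ.p, Branch.root))).trans ?_)
      (key x')
    rw [Nat.cast_add, SimpleGraph.edist_comm]
    exact add_le_add (key x)
      ((edgeLipschitz_centre.edist_le_edist _ _).trans (edgeLipschitz_map σ.p h))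
  | branch x h =>
    cases x with
    | none =>
      exact ((edgeLipschitz_branch _).edist_le_edist _ _).trans
        (σ.edist_mergeBranch_le hN hu hv h _ _)
    | some y =>
      exact ((edgeLipschitz_branch _).edist_le_edist _ _).trans
        (σ.edist_mergeBranch_le hN hu hv h _ _)

end Merge

section Split

variable {R : ℕ} {Z : Type*} {H : SimpleGraph Z}

/-- Since `split` fixes a lift only after reading the tail, prefixes cannot be peeled off as for
`merge`. Instead `φ j` records how the `j`-th candidate branch sits in the target, and each letter
turns `φ` into a new family `ψ`. The invariant is that the roots of the candidates stay close: at
`v` they are joined through the root of branch zero (`2 * R`), and within one fibre they are at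
distance at most one. -/
theorem splitBranch_cons
    (hu : ∀ y, σ.p y = u.2 → (branchGraph (coverGraph σ.p Gα) Gγ).edist Branch.root
      (Branch.cons (u.1, y) Branch.root) ≤ R)
    (hv : ∀ y, σ.p y = v.2 → (branchGraph (coverGraph σ.p Gα) Gγ).edist Branch.root
      (Branch.cons (v.1, y) Branch.root) ≤ R)
    {φ : ℕ → Branch Y γ → Z}
    (hφ : ∀ j, EdgeLipschitz (branchGraph (coverGraph σ.p Gα) Gγ) H (φ j) 1)
    (hφ' : ∀ i j, H.edist (φ i Branch.root) (φ j Branch.root) ≤ (2 * R + 1 : ℕ))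
    (k : ℕ) (x : γ × α) :
    ∃ (k' : ℕ) (ψ : ℕ → Branch Y γ → Z),
      (∀ j, EdgeLipschitz (branchGraph (coverGraph σ.p Gα) Gγ) H (ψ j) 1) ∧
      (∀ i j, H.edist (ψ i Branch.root) (ψ j Branch.root) ≤ (2 * R + 1 : ℕ)) ∧
      ∀ t, φ (σ.splitBranch u v k (Branch.cons x t)).1 (σ.splitBranch u v k (Branch.cons x t)).2 =
        ψ (σ.splitBranch u v k' t).1 (σ.splitBranch u v k' t).2 := by
  by_cases h : 1 < k ∧ x = u
  · refine ⟨k - 1, fun j => φ (j + 1), fun j => hφ _, fun i j => hφ' _ _, fun t => ?_⟩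
    simp only [splitBranch, Branch.cons]
    rw [split]
    simp only [if_pos h]
  by_cases h' : 1 < k ∧ x = v
  · refine ⟨σ.n u.2 + σ.n v.2, fun j => φ 0 ∘ Branch.cons (if j < σ.n v.2 then (v.1, σ.pt v.2 j)
      else (u.1, σ.pt u.2 (j - σ.n v.2))), fun j => (hφ 0).comp (edgeLipschitz_cons _),
      fun i j => ?_, fun t => ?_⟩
    · refine ((hφ 0).edist_le_edist _ _).trans ?_
      have key : ∀ j, (branchGraph (coverGraph σ.p Gα) Gγ).edist Branch.root
          (Branch.cons (if j < σ.n v.2 then (v.1, σ.pt v.2 j)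
            else (u.1, σ.pt u.2 (j - σ.n v.2))) Branch.root) ≤ R := by
        intro j
        split_ifs
        · exact hv _ (σ.p_pt _ _)
        · exact hu _ (σ.p_pt _ _)
      refine (SimpleGraph.edist_triangle (v := Branch.root)).trans ?_
      rw [SimpleGraph.edist_comm]
      refine (add_le_add (key i) (key j)).trans ?_
      exact_mod_cast by omega
    · simp only [splitBranch, Branch.cons]
      rw [split]
      simp only [if_neg h, if_pos h']
      rfl
  · refine ⟨σ.n x.2, fun j => φ 0 ∘ Branch.cons (x.1, σ.pt x.2 j),
      fun j => (hφ 0).comp (edgeLipschitz_cons _), fun i j => ?_, fun t => ?_⟩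
    · refine ((hφ 0).edist_le_edist _ _).trans
        (((edgeLipschitz_side x.1).edist_le_edist (some _) (some _)).trans
          ((σ.edist_coverGraph_le_one (by simp [σ.p_pt])).trans ?_))
      exact_mod_cast by omega
    · simp only [splitBranch, Branch.cons]
      rw [split]
      simp only [if_neg h, if_neg h']
      rfl

/-- Only the slot `u` is moved: it becomes the root of branch one, which is within `2 * R + 1` of
the root of branch zero, and from there the old slot is within `R`. -/
theorem edist_splitBranch_side_le
    (hu : ∀ y, σ.p y = u.2 → (branchGraph (coverGraph σ.p Gα) Gγ).edist Branch.root
      (Branch.cons (u.1, y) Branch.root) ≤ R)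
    {φ : ℕ → Branch Y γ → Z}
    (hφ : ∀ j, EdgeLipschitz (branchGraph (coverGraph σ.p Gα) Gγ) H (φ j) 1)
    (hφ' : ∀ i j, H.edist (φ i Branch.root) (φ j Branch.root) ≤ (2 * R + 1 : ℕ))
    (k : ℕ) (c : γ) (x : Option α) :
    H.edist (φ (σ.splitBranch u v k (Branch.side c x)).1 (σ.splitBranch u v k (Branch.side c x)).2)
      (φ 0 (Branch.side c (x.map (σ.pt · 0)))) ≤ (3 * R + 1 : ℕ) := by
  cases x with
  | none => simp [Branch.side, splitBranch_nil]
  | some a =>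
    simp only [splitBranch, Branch.cons, Branch.side, Branch.root, Option.map_some]
    rw [split]
    split_ifs with h h' h''
    · simp only [split]
      have := hu (σ.pt a 0) (by rw [σ.p_pt, ← h.2])
      rw [← h.2] at this
      refine (SimpleGraph.edist_triangle (v := φ 0 Branch.root)).trans
        ((add_le_add (hφ' 1 0) (((hφ 0).edist_le_edist _ _).trans this)).trans ?_)
      exact_mod_cast by omega
    · simp only [split]
      simp [← h'.2]
    · exact absurd (σ.n_pos _) (by simpa [split] using h'')
    · simp [split]

theorem edist_splitBranch_le
    (hu : ∀ y, σ.p y = u.2 → (branchGraph (coverGraph σ.p Gα) Gγ).edist Branch.root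
      (Branch.cons (u.1, y) Branch.root) ≤ R)
    (hv : ∀ y, σ.p y = v.2 → (branchGraph (coverGraph σ.p Gα) Gγ).edist Branch.root
      (Branch.cons (v.1, y) Branch.root) ≤ R)
    {t t' : Branch α γ} (h : BranchRel Gα Gγ t t') :
    ∀ {φ : ℕ → Branch Y γ → Z} (_ : ∀ j, EdgeLipschitz (branchGraph (coverGraph σ.p Gα) Gγ) H
        (φ j) 1)
      (_ : ∀ i j, H.edist (φ i Branch.root) (φ j Branch.root) ≤ (2 * R + 1 : ℕ)) (k : ℕ),
      H.edist (φ (σ.splitBranch u v k t).1 (σ.splitBranch u v k t).2)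
        (φ (σ.splitBranch u v k t').1 (σ.splitBranch u v k t').2) ≤
          ((3 * R + 1) + 1 + (3 * R + 1) : ℕ) := by
  induction h with
  | base h =>
    intro φ hφ hφ' k
    rw [splitBranch_nil, splitBranch_nil]
    refine ((hφ 0).edist_le_edist _ _).trans ((edist_fromRel_le_one (.base h)).trans ?_)
    exact_mod_cast by omega
  | @side c x x' h =>
    intro φ hφ hφ' k
    refine (SimpleGraph.edist_triangle (v := φ 0 (Branch.side c (x'.map (σ.pt · 0))))).trans ?_
    rw [Nat.cast_add]
    refine add_le_add ((SimpleGraph.edist_triangle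
      (v := φ 0 (Branch.side c (x.map (σ.pt · 0))))).trans ?_) ?_
    · rw [Nat.cast_add]
      exact add_le_add (σ.edist_splitBranch_side_le hu hφ hφ' k c x)
        (((hφ 0).edist_le_edist _ _).trans (((edgeLipschitz_side c).edist_le_edist _ _).trans
          (σ.edgeLipschitz_map_pt h)))
    · rw [SimpleGraph.edist_comm]
      exact σ.edist_splitBranch_side_le hu hφ hφ' k c x'
  | cons x _ ih =>
    intro φ hφ hφ' k
    obtain ⟨k', ψ, hψ, hψ', h⟩ := σ.splitBranch_cons hu hv hφ hφ' k x
    rw [h, h]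
    exact ih hψ hψ' k'

theorem edgeLipschitz_treeEquiv_symm (huv : u ≠ v)
    (hu : ∀ y, σ.p y = u.2 → (branchGraph (coverGraph σ.p Gα) Gγ).edist Branch.root
      (Branch.cons (u.1, y) Branch.root) ≤ R)
    (hv : ∀ y, σ.p y = v.2 → (branchGraph (coverGraph σ.p Gα) Gγ).edist Branch.root
      (Branch.cons (v.1, y) Branch.root) ≤ R) :
    EdgeLipschitz (treeGraph Gα Gγ) (treeGraph (coverGraph σ.p Gα) Gγ) (σ.treeEquiv huv).symm
      ((3 * R + 1) + 1 + (3 * R + 1)) := by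
  have key : ∀ x : Option α, (σ.treeEquiv huv).symm (x, Branch.root) =
      (x.map (σ.pt · 0), (Branch.root : Branch Y γ)) := by
    rintro (_ | a) <;> simp [treeEquiv, Branch.root, splitBranch_nil]
  refine edgeLipschitz_fromRel fun z z' h => ?_
  induction h with
  | @centre x x' h =>
    rw [key, key]
    refine (edgeLipschitz_centre.edist_le_edist _ _).trans ((σ.edgeLipschitz_map_pt h).trans ?_)
    exact_mod_cast by omega
  | branch x h =>
    cases x with
    | none =>
      exact σ.edist_splitBranch_le hu hv h (φ := fun _ t => (none, t))
        (fun _ => edgeLipschitz_branch _) (fun _ _ => by simp) 1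
    | some a =>
      -- The initial candidates are the branches at the points of the fibre over `a`, whose roots
      -- are at distance at most one.
      refine σ.edist_splitBranch_le hu hv h (φ := fun j t => (some (σ.pt a j), t))
        (fun _ => edgeLipschitz_branch _) (fun i j => ?_) (σ.n a)
      refine (edgeLipschitz_centre.edist_le_edist _ _).trans
        ((σ.edist_coverGraph_le_one (by simp [σ.p_pt])).trans ?_)
      exact_mod_cast by omega

end Split

theorem bilipschitzEquivalent_coverGraph (hα : Gα.Connected) (hγ : Gγ.Connected) {N : ℕ}
    (hN : ∀ a, σ.n a ≤ N) [Nontrivial (γ × α)] :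
    BilipschitzEquivalent (treeGraph (coverGraph σ.p Gα) Gγ) (treeGraph Gα Gγ) := by
  obtain ⟨u, v, huv⟩ := exists_pair_ne (γ × α)
  obtain ⟨R₁, h₁⟩ := edist_root_cons_le hα hγ u
  obtain ⟨R₂, h₂⟩ := edist_root_cons_le hα hγ v
  obtain ⟨R₃, h₃⟩ := σ.edist_root_cons_coverGraph_le hα hγ u
  obtain ⟨R₄, h₄⟩ := σ.edist_root_cons_coverGraph_le hα hγ v
  obtain ⟨R, hR₁, hR₂, hR₃, hR₄⟩ : ∃ R, R₁ ≤ R ∧ R₂ ≤ R ∧ R₃ ≤ R ∧ R₄ ≤ R :=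
    ⟨R₁ + R₂ + R₃ + R₄, by omega, by omega, by omega, by omega⟩
  exact ⟨σ.treeEquiv huv, _,
    (σ.edgeLipschitz_treeEquiv huv hN (h₁.trans (by exact_mod_cast hR₁))
      (h₂.trans (by exact_mod_cast hR₂))).mono (le_max_left _ _),
    (σ.edgeLipschitz_treeEquiv_symm huv (fun y hy => (h₃ y hy).trans (by exact_mod_cast hR₃))
      (fun y hy => (h₄ y hy).trans (by exact_mod_cast hR₄))).mono (le_max_right _ _)⟩

end Splitting

end Cover

/-! ### Normal forms in a free product and its Cayley graph. -/

section NormalForm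

open Monoid

variable {α γ A C : Type*}

/-- The two ways of describing the vertices of a tree of spaces, by the space at the centre and
by the space attached to the root of the latter. -/
def regroup : Option γ × Option (α × Branch α γ) ≃ Option α × Branch α γ where
  toFun
    -- The first coordinate is the leading syllable from `C`, trivial if the word starts in `A`; the
    -- second is what follows it.
    | (d, none) => (none, [], d)
    | (none, some (a, t)) => (some a, t)
    | (some c, some (a, t)) => (none, Branch.cons (c, a) t)
  invFun
    | (none, [], d) => (d, none)
    | (none, z :: l, d) => (some z.1, some (z.2, l, d))
    | (some a, t) => (none, some (a, t))
  left_inv := by rintro ⟨_ | c, _ | ⟨a, t⟩⟩ <;> rfl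
  right_inv := by rintro ⟨_ | a, _ | ⟨z, l⟩, d⟩ <;> rfl

/-- The action of a group on a product with a set in bijection with the group. -/
def permHom {X W V G : Type*} [Group G] (e : X ≃ G) (θ : X × W ≃ V) : G →* Equiv.Perm V where
  toFun g := θ.permCongr ((e.symm.permCongr (Equiv.mulLeft g)).prodCongr (Equiv.refl W))
  map_one' := by
    ext v
    obtain ⟨⟨x, w⟩, rfl⟩ := θ.surjective v
    simp [Equiv.permCongr_apply]
  map_mul' g h := by
    ext v
    obtain ⟨⟨x, w⟩, rfl⟩ := θ.surjective v
    simp [Equiv.permCongr_apply]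

theorem permHom_apply {X W V G : Type*} [Group G] (e : X ≃ G) (θ : X × W ≃ V) (g : G) (x : X)
    (w : W) : permHom e θ g (θ (x, w)) = θ (e.symm (g * e x), w) := by
  simp [permHom, Equiv.permCongr_apply]

variable [Group A] [Group C] (eA : Option α ≃ A) (eC : Option γ ≃ C)

/-- The action of the free product on its normal forms. -/
def normalFormAction : Coprod A C →* Equiv.Perm (Option α × Branch α γ) :=
  Coprod.lift (permHom eA (Equiv.refl _)) (permHom eC regroup)

/-- The element of the free product with a given normal form, without the first letter. -/
def branchVal (t : Branch α γ) : Coprod A C :=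
  (t.1.map fun z => (Coprod.inr (eC (some z.1)) * Coprod.inl (eA (some z.2)) : Coprod A C)).prod *
    Coprod.inr (eC t.2)

/-- The element of the free product with a given normal form. -/
def treeVal (z : Option α × Branch α γ) : Coprod A C :=
  Coprod.inl (eA z.1) * branchVal eA eC z.2

theorem branchVal_cons (x : γ × α) (t : Branch α γ) :
    branchVal eA eC (Branch.cons x t) =
      Coprod.inr (eC (some x.1)) * (Coprod.inl (eA (some x.2)) * branchVal eA eC t) := by
  simp [branchVal, Branch.cons, mul_assoc]

theorem branchVal_nil (c : Option γ) : branchVal eA eC ([], c) = Coprod.inr (eC c) := by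
  simp [branchVal]

variable {eA eC}

theorem normalFormAction_inl (a : A) (x : Option α) (t : Branch α γ) :
    normalFormAction eA eC (Coprod.inl a) (x, t) = (eA.symm (a * eA x), t) := by
  simpa [normalFormAction] using permHom_apply eA (Equiv.refl _) a x t

theorem normalFormAction_inr (c : C) (x : Option γ) (t : Option (α × Branch α γ)) :
    normalFormAction eA eC (Coprod.inr c) (regroup (x, t)) = regroup (eC.symm (c * eC x), t) := by
  simpa [normalFormAction] using permHom_apply eC regroup c x t

theorem branchVal_side (hA : eA none = 1) (hC : eC none = 1)
    (c : γ) (x : Option α) :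
    branchVal eA eC (Branch.side c x) = Coprod.inr (eC (some c)) * Coprod.inl (eA x) := by
  cases x with
  | none => simp [Branch.side, branchVal_nil, hA]
  | some a => simp [Branch.side, branchVal_cons, Branch.root, branchVal_nil, hC]

theorem treeVal_regroup (hA : eA none = 1) (hC : eC none = 1)
    (x : Option γ) (t : Option (α × Branch α γ)) :
    treeVal eA eC (regroup (x, t)) = Coprod.inr (eC x) *
      (t.elim 1 fun t => Coprod.inl (eA (some t.1)) * branchVal eA eC t.2) := by
  rcases x with _ | c <;> rcases t with _ | ⟨a, t⟩ <;>
    simp [regroup, treeVal, hA, hC, branchVal_nil, branchVal_cons]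

theorem normalFormAction_branchVal (hA : eA none = 1) (hC : eC none = 1)
    (t : Branch α γ) :
    normalFormAction eA eC (branchVal eA eC t) (none, Branch.root) = (none, t) := by
  obtain ⟨l, c⟩ := t
  induction l with
  | nil =>
    have := normalFormAction_inr (eA := eA) (eC := eC) (eC c) none none
    rw [hC, mul_one, Equiv.symm_apply_apply] at this
    rw [branchVal_nil]
    exact this
  | cons z l ih =>
    have h := branchVal_cons eA eC z (l, c)
    have := normalFormAction_inr (eA := eA) (eC := eC) (eC (some z.1)) none (some (z.2, l, c))
    rw [hC, mul_one, Equiv.symm_apply_apply] at this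
    rw [Branch.cons] at h
    rw [h, map_mul, map_mul, Equiv.Perm.mul_apply, Equiv.Perm.mul_apply, ih,
      normalFormAction_inl, hA, mul_one, Equiv.symm_apply_apply]
    exact this

/-- Uniqueness by van der Waerden's trick: the element acts on the empty normal form and returns the
normal form it came from. -/
theorem normalFormAction_treeVal (hA : eA none = 1) (hC : eC none = 1)
    (z : Option α × Branch α γ) :
    normalFormAction eA eC (treeVal eA eC z) (none, Branch.root) = z := by
  rw [treeVal, map_mul, Equiv.Perm.mul_apply, normalFormAction_branchVal hA hC,
    normalFormAction_inl, hA, mul_one, Equiv.symm_apply_apply]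

/-- Equivariance for left multiplication; at the empty normal form it gives existence of normal
forms. -/
theorem treeVal_normalFormAction (hA : eA none = 1) (hC : eC none = 1)
    (g : Coprod A C) :
    ∀ z, treeVal eA eC (normalFormAction eA eC g z) = g * treeVal eA eC z := by
  induction g using Coprod.induction_on' with
  | one => simp
  | inl_mul a g ih =>
    intro z
    rw [map_mul, Equiv.Perm.mul_apply, mul_assoc, ← ih z]
    generalize normalFormAction eA eC g z = y
    obtain ⟨x, t⟩ := y
    rw [normalFormAction_inl]
    simp [treeVal, mul_assoc]
  | inr_mul c g ih =>
    intro z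
    rw [map_mul, Equiv.Perm.mul_apply, mul_assoc, ← ih z]
    generalize normalFormAction eA eC g z = y
    obtain ⟨⟨x, t⟩, rfl⟩ := regroup.surjective y
    rw [normalFormAction_inr, treeVal_regroup hA hC, treeVal_regroup hA hC]
    simp [mul_assoc]

/-- The normal form theorem for free products. -/
def normalFormEquiv (hA : eA none = 1) (hC : eC none = 1) :
    Option α × Branch α γ ≃ Coprod A C where
  toFun := treeVal eA eC
  invFun g := normalFormAction eA eC g (none, Branch.root)
  left_inv := normalFormAction_treeVal hA hC
  right_inv g := by
    rw [treeVal_normalFormAction hA hC]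
    simp [treeVal, Branch.root, branchVal_nil, hA, hC]

theorem adj_map_of_injective {G H : Type*} [Group G] [Group H] {S : Set G} {T : Set H}
    (f : G →* H) (hf : Function.Injective f) (hST : ∀ s ∈ S, f s ∈ T) {g g' : G}
    (h : (SimpleGraph.mulCayley S).Adj g g') : (SimpleGraph.mulCayley T).Adj (f g) (f g') := by
  rw [SimpleGraph.mulCayley_adj'] at h ⊢
  obtain ⟨hne, s, hs, h⟩ := h
  refine ⟨hf.ne hne, f s, hST s hs, ?_⟩
  rw [← map_mul, ← map_mul]
  exact h.imp (congrArg f) (congrArg f)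

theorem adj_inl (S : Set A) (T : Set C) {a a' : A} (h : (SimpleGraph.mulCayley S).Adj a a') :
    (SimpleGraph.mulCayley (Coprod.inl '' S ∪ Coprod.inr '' T : Set (Coprod A C))).Adj
      (Coprod.inl a) (Coprod.inl a') :=
  adj_map_of_injective (S := S) _ Coprod.inl_injective
    (fun _ hs => Set.mem_union_left _ (Set.mem_image_of_mem _ hs)) h

theorem adj_inr (S : Set A) (T : Set C) {c c' : C} (h : (SimpleGraph.mulCayley T).Adj c c') :
    (SimpleGraph.mulCayley (Coprod.inl '' S ∪ Coprod.inr '' T : Set (Coprod A C))).Adj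
      (Coprod.inr c) (Coprod.inr c') :=
  adj_map_of_injective (S := T) _ Coprod.inr_injective
    (fun _ hs => Set.mem_union_right _ (Set.mem_image_of_mem _ hs)) h

theorem adj_branchVal (hA : eA none = 1) (hC : eC none = 1)
    (S : Set A) (T : Set C) {t t' : Branch α γ}
    (h : BranchRel ((SimpleGraph.mulCayley S).comap eA) ((SimpleGraph.mulCayley T).comap eC) t t') :
    (SimpleGraph.mulCayley (Coprod.inl '' S ∪ Coprod.inr '' T : Set (Coprod A C))).Adj
      (branchVal eA eC t) (branchVal eA eC t') := by
  induction h with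
  | base h =>
    rw [branchVal_nil, branchVal_nil]
    exact adj_inr S T h
  | side c h =>
    rw [branchVal_side hA hC, branchVal_side hA hC, SimpleGraph.mulCayley_adj_mul_iff_right]
    exact adj_inl S T h
  | cons x _ ih =>
    rw [branchVal_cons, branchVal_cons, SimpleGraph.mulCayley_adj_mul_iff_right,
      SimpleGraph.mulCayley_adj_mul_iff_right]
    exact ih

theorem edist_comap_mul_le {X G : Type*} [Group G] (e : X ≃ G) {S : Set G} {s : G} (hs : s ∈ S)
    (x : X) :
    ((SimpleGraph.mulCayley S).comap e).edist x (e.symm (e x * s)) ≤ 1 := by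
  by_cases h : e x = e x * s
  · rw [← h]; simp
  · refine (SimpleGraph.edist_eq_one_iff_adj.2 ?_).le
    rw [SimpleGraph.comap_adj, Equiv.apply_symm_apply, SimpleGraph.mulCayley_adj']
    exact ⟨h, s, hs, Or.inl rfl⟩

theorem exists_branchVal_mul_inr (T : Set C) {s : C} (hs : s ∈ T) (t : Branch α γ)
    (Gα : SimpleGraph (Option α)) : ∃ t', branchVal eA eC t' = branchVal eA eC t * Coprod.inr s ∧
      (branchGraph Gα ((SimpleGraph.mulCayley T).comap eC)).edist t t' ≤ 1 := by
  obtain ⟨l, c⟩ := t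
  induction l with
  | nil =>
    refine ⟨([], eC.symm (eC c * s)), by simp [branchVal_nil], ?_⟩
    exact (edgeLipschitz_base.edist_le_edist _ _).trans (edist_comap_mul_le eC hs c)
  | cons z l ih =>
    obtain ⟨t', h, h'⟩ := ih
    refine ⟨Branch.cons z t', ?_, ((edgeLipschitz_cons z).edist_le_edist (l, c) t').trans h'⟩
    rw [branchVal_cons, h, ← mul_assoc, ← mul_assoc, mul_assoc _ _ (branchVal eA eC (l, c)),
      ← branchVal_cons]
    rfl

/-- Right multiplication changes only the last syllable. At the root of the branch that syllable
lies outside the branch, in the space it is attached to, hence the exclusion. -/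
theorem exists_branchVal_mul_inl (hA : eA none = 1) (hC : eC none = 1)
    (S : Set A) {s : A} (hs : s ∈ S) (t : Branch α γ) (ht : t ≠ Branch.root)
    (Gγ : SimpleGraph (Option γ)) : ∃ t', branchVal eA eC t' = branchVal eA eC t * Coprod.inl s ∧
      (branchGraph ((SimpleGraph.mulCayley S).comap eA) Gγ).edist t t' ≤ 1 := by
  have key : ∀ (c : γ) (x : Option α), ∃ t',
      branchVal eA eC t' = branchVal eA eC (Branch.side c x) * Coprod.inl s ∧
      (branchGraph ((SimpleGraph.mulCayley S).comap eA) Gγ).edist (Branch.side c x) t' ≤ 1 := by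
    intro c x
    refine ⟨Branch.side c (eA.symm (eA x * s)), ?_, ?_⟩
    · rw [branchVal_side hA hC, branchVal_side hA hC]
      simp [mul_assoc]
    · exact ((edgeLipschitz_side c).edist_le_edist _ _).trans (edist_comap_mul_le eA hs x)
  obtain ⟨l, c⟩ := t
  induction l with
  | nil =>
    cases c with
    | none => exact absurd rfl ht
    | some c => exact key c none
  | cons z l ih =>
    by_cases h : ((l, c) : Branch α γ) = Branch.root
    · have := key z.1 (some z.2)
      rw [Branch.side, ← h] at this
      exact this
    · obtain ⟨t', h, h'⟩ := ih h
      refine ⟨Branch.cons z t', ?_, ((edgeLipschitz_cons z).edist_le_edist (l, c) t').trans h'⟩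
      rw [branchVal_cons, h, ← mul_assoc, ← mul_assoc, mul_assoc _ _ (branchVal eA eC (l, c)),
        ← branchVal_cons]
      rfl

theorem bilipschitzEquivalent_mulCayley_coprod (hA : eA none = 1) (hC : eC none = 1)
    (S : Set A) (T : Set C) :
    BilipschitzEquivalent
      (treeGraph ((SimpleGraph.mulCayley S).comap eA) ((SimpleGraph.mulCayley T).comap eC))
      (SimpleGraph.mulCayley (Coprod.inl '' S ∪ Coprod.inr '' T : Set (Coprod A C))) := by
  set Γ := treeGraph ((SimpleGraph.mulCayley S).comap eA) ((SimpleGraph.mulCayley T).comap eC)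
  have hinj := (normalFormEquiv hA hC).injective
  have key : ∀ s ∈ (Coprod.inl '' S ∪ Coprod.inr '' T : Set (Coprod A C)),
      ∀ z z', normalFormEquiv hA hC z * s = normalFormEquiv hA hC z' → Γ.edist z z' ≤ 1 := by
    intro s hs z z' h
    suffices H : ∃ z'', normalFormEquiv hA hC z'' = normalFormEquiv hA hC z * s ∧
        Γ.edist z z'' ≤ 1 by
      obtain ⟨z'', h₁, h₂⟩ := H
      rwa [hinj (h₁.trans h)] at h₂
    obtain ⟨x, t⟩ := z
    rcases hs with ⟨s, hs, rfl⟩ | ⟨s, hs, rfl⟩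
    · by_cases ht : t = Branch.root
      · subst ht
        refine ⟨(eA.symm (eA x * s), Branch.root), ?_, ?_⟩
        · simp [normalFormEquiv, treeVal, Branch.root, branchVal_nil, hC]
        · exact (edgeLipschitz_centre.edist_le_edist _ _).trans (edist_comap_mul_le eA hs x)
      · obtain ⟨t', h₁, h₂⟩ := exists_branchVal_mul_inl hA hC S hs t ht
          ((SimpleGraph.mulCayley T).comap eC)
        refine ⟨(x, t'), ?_, ((edgeLipschitz_branch x).edist_le_edist _ _).trans h₂⟩
        simp [normalFormEquiv, treeVal, h₁, mul_assoc]
    · obtain ⟨t', h₁, h₂⟩ := exists_branchVal_mul_inr (eA := eA) (eC := eC) T hs t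
        ((SimpleGraph.mulCayley S).comap eA)
      refine ⟨(x, t'), ?_, ((edgeLipschitz_branch x).edist_le_edist _ _).trans h₂⟩
      simp [normalFormEquiv, treeVal, h₁, mul_assoc]
  refine ⟨normalFormEquiv hA hC, 1, edgeLipschitz_fromRel fun z z' h => ?_, fun g g' h => ?_⟩
  · refine (SimpleGraph.edist_eq_one_iff_adj.2 ?_).le
    induction h with
    | centre h =>
      simp only [normalFormEquiv, Equiv.coe_fn_mk, treeVal, Branch.root, branchVal_nil, hC,
        map_one, mul_one]
      exact adj_inl S T h
    | branch x h =>
      simp only [normalFormEquiv, Equiv.coe_fn_mk, treeVal]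
      rw [SimpleGraph.mulCayley_adj_mul_iff_right]
      exact adj_branchVal hA hC S T h
  · obtain ⟨z, rfl⟩ := (normalFormEquiv hA hC).surjective g
    obtain ⟨z', rfl⟩ := (normalFormEquiv hA hC).surjective g'
    rw [Equiv.symm_apply_apply, Equiv.symm_apply_apply]
    obtain ⟨-, s, hs, h | h⟩ := (SimpleGraph.mulCayley_adj' _ _ _).1 h
    · exact key s hs _ _ h
    · rw [SimpleGraph.edist_comm]
      exact key s hs _ _ h.symm

end NormalForm

/-! ### Balls and generating sets in Cayley graphs. -/

section Cayley

variable {G : Type*} [Group G]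

theorem finite_neighborSet_mulCayley {S : Set G} (hS : S.Finite) (u : G) :
    ((SimpleGraph.mulCayley S).neighborSet u).Finite := by
  refine ((hS.image (u * ·)).union (hS.image (u * ·⁻¹))).subset fun v hv => ?_
  obtain ⟨-, s, hs, h | h⟩ := (SimpleGraph.mulCayley_adj' _ _ _).1 hv
  · exact Or.inl ⟨s, hs, h⟩
  · exact Or.inr ⟨s, hs, mul_inv_eq_of_eq_mul h⟩

theorem finite_walk_length_eq {X : Type*} {Γ : SimpleGraph X} (h : ∀ u, (Γ.neighborSet u).Finite)
    (n : ℕ) : ∀ u, {v | ∃ w : Γ.Walk u v, w.length = n}.Finite := by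
  induction n with
  | zero =>
    refine fun u => (Set.finite_singleton u).subset ?_
    rintro v ⟨w, hw⟩
    exact (SimpleGraph.Walk.eq_of_length_eq_zero hw).symm
  | succ n ih =>
    refine fun u => ((h u).biUnion fun v _ => ih v).subset ?_
    rintro v ⟨_ | ⟨hadj, w⟩, hw⟩
    · simp at hw
    · exact Set.mem_biUnion (hadj : _ ∈ Γ.neighborSet u) ⟨w, by simpa using hw⟩

theorem finite_setOf_dist_le {S : Set G} (hS : S.Finite)
    (hc : (SimpleGraph.mulCayley S).Connected) (n : ℕ) :
    {g | (SimpleGraph.mulCayley S).dist 1 g ≤ n}.Finite := by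
  refine ((Set.finite_Iic n).biUnion fun k _ =>
    finite_walk_length_eq (finite_neighborSet_mulCayley hS) k 1).subset fun g hg => ?_
  obtain ⟨w, hw⟩ := hc.exists_walk_length_eq_dist 1 g
  exact Set.mem_biUnion (show _ ∈ Set.Iic n from hg) ⟨w, hw⟩

theorem dist_mulCayley_mul_left_le {S : Set G} (hc : (SimpleGraph.mulCayley S).Connected)
    (g u v : G) :
    (SimpleGraph.mulCayley S).dist (g * u) (g * v) ≤ (SimpleGraph.mulCayley S).dist u v := by
  have h : EdgeLipschitz (SimpleGraph.mulCayley S) (SimpleGraph.mulCayley S) (g * ·) 1 :=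
    fun x y hxy => (SimpleGraph.edist_eq_one_iff_adj.2
      (SimpleGraph.mulCayley_adj_mul_iff_right.2 hxy)).le
  simpa using h.dist_le hc u v

theorem closure_inl_union_inr {A C : Type*} [Group A] [Group C] {S : Set A} {T : Set C}
    (hS : Subgroup.closure S = ⊤) (hT : Subgroup.closure T = ⊤) :
    Subgroup.closure (Monoid.Coprod.inl '' S ∪ Monoid.Coprod.inr '' T : Set (Monoid.Coprod A C)) =
      ⊤ := by
  rw [Subgroup.closure_union, ← MonoidHom.map_closure, ← MonoidHom.map_closure, hS, hT,
    ← MonoidHom.range_eq_map, ← MonoidHom.range_eq_map, Monoid.Coprod.range_inl_sup_range_inr]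

end Cayley

/-! ### From a coarse relation to an equivalence of free products. -/

section Relation

theorem exists_splitting {Y α : Type*} (p : Y → α) (hp : Function.Surjective p)
    (h : ∀ a, (p ⁻¹' {a}).Finite) :
    ∃ σ : Splitting Y α, σ.p = p ∧ ∀ a, σ.n a = (p ⁻¹' {a}).ncard := by
  classical
  have e : ∀ a, (p ⁻¹' {a} : Set Y) ≃ Fin (p ⁻¹' {a}).ncard := fun a =>
    haveI := (h a).to_subtype
    Finite.equivFin _
  refine ⟨⟨p, fun y => (e (p y) ⟨y, rfl⟩ : ℕ), fun a => (p ⁻¹' {a}).ncard,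
    fun a j => if hj : j < (p ⁻¹' {a}).ncard then ((e a).symm ⟨j, hj⟩ : Y) else (hp a).choose,
    fun a j => ?_, fun a j hj => ?_, fun y => (e (p y) ⟨y, rfl⟩).2, fun y => ?_⟩, rfl, fun _ => rfl⟩
  · split_ifs with hj
    · exact ((e a).symm ⟨j, hj⟩).2
    · exact (hp a).choose_spec
  · have key : ∀ (a : α) (y : Y) (z : (p ⁻¹' {a} : Set Y)), y = z →
        (e (p y) ⟨y, rfl⟩ : ℕ) = e a z := by
      rintro a y ⟨z, hz⟩ rfl
      obtain rfl : p y = a := hz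
      rfl
    exact (key a _ _ (dif_pos hj)).trans (by rw [Equiv.apply_symm_apply])
  · simp

/-- Left translation moves the image under `f` of each fibre into the ball of radius `K` about the
identity, whose cardinality is the uniform bound. -/
theorem exists_splitting_of_dist_le {Y α G : Type*} [Group G] {T : Set G} (hT : T.Finite)
    (hc : (SimpleGraph.mulCayley T).Connected) (p : Y → α) (hp : Function.Surjective p)
    (f : Y → G) (hf : ∀ y y', p y = p y' → f y = f y' → y = y') {K : ℕ}
    (hK : ∀ y y', p y = p y' → (SimpleGraph.mulCayley T).dist (f y) (f y') ≤ K) :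
    ∃ (σ : Splitting Y α) (N : ℕ), σ.p = p ∧ ∀ a, σ.n a ≤ N := by
  have hfin := finite_setOf_dist_le hT hc K
  have key : ∀ a, ∃ φ : Y → G,
      Set.MapsTo φ (p ⁻¹' {a}) {g | (SimpleGraph.mulCayley T).dist 1 g ≤ K} ∧
      Set.InjOn φ (p ⁻¹' {a}) := by
    intro a
    obtain ⟨y₀, rfl⟩ := hp a
    refine ⟨fun y => (f y₀)⁻¹ * f y, fun y hy => ?_, fun y hy y' hy' h => ?_⟩
    · have := dist_mulCayley_mul_left_le hc (f y₀)⁻¹ (f y₀) (f y)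
      rw [inv_mul_cancel] at this
      exact this.trans (hK _ _ hy.symm)
    · exact hf _ _ (hy.trans hy'.symm) (mul_left_cancel h)
  obtain ⟨σ, hσ, hn⟩ := exists_splitting p hp fun a => by
    obtain ⟨φ, h₁, h₂⟩ := key a
    exact Set.Finite.of_injOn h₁ h₂ hfin
  refine ⟨σ, {g | (SimpleGraph.mulCayley T).dist 1 g ≤ K}.ncard, hσ, fun a => ?_⟩
  obtain ⟨φ, h₁, h₂⟩ := key a
  rw [hn]
  exact Set.ncard_le_ncard_of_injOn φ h₁ h₂ hfin

/-- The path goes to the chosen point of the fibre of `σ.p`, then along the lift of a path of length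
at most `K`, then back into the other fibre. -/
theorem edgeLipschitz_coverGraph_id {α β Y : Type*} (p : Y → α) (σ : Splitting Y β)
    {Gα : SimpleGraph (Option α)} {Gβ : SimpleGraph (Option β)} {K : ℕ}
    (h : ∀ y y' : Option Y, Gα.edist (y.map p) (y'.map p) ≤ 1 →
      Gβ.edist (y.map σ.p) (y'.map σ.p) ≤ K) :
    EdgeLipschitz (coverGraph p Gα) (coverGraph σ.p Gβ) id (1 + K + 1) := by
  refine edgeLipschitz_fromRel fun y y' hy => ?_
  refine (SimpleGraph.edist_triangle (v := (y'.map σ.p).map (σ.pt · 0))).trans ?_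
  push_cast
  refine add_le_add ((SimpleGraph.edist_triangle (v := (y.map σ.p).map (σ.pt · 0))).trans ?_)
    (σ.edist_coverGraph_le_one (σ.map_p_map_pt _))
  exact add_le_add (σ.edist_coverGraph_le_one (σ.map_p_map_pt _).symm)
    ((σ.edgeLipschitz_map_pt.edist_le_edist _ _).trans (h y y' hy))

variable {A B C Y α β γ : Type*} [Group A] [Group B] [Group C]

theorem edist_comap_le_dist {S : Set A} (hS : (SimpleGraph.mulCayley S).Connected)
    (e : Option α ≃ A) (x x' : Option α) :
    ((SimpleGraph.mulCayley S).comap e).edist x x' ≤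
      ((SimpleGraph.mulCayley S).dist (e x) (e x') : ℕ) := by
  have h : EdgeLipschitz (SimpleGraph.mulCayley S) ((SimpleGraph.mulCayley S).comap e) e.symm 1 :=
    fun a a' haa => (SimpleGraph.edist_eq_one_iff_adj.2 (by simpa using haa)).le
  rw [(hS _ _).coe_dist_eq_edist]
  simpa using h.edist_le_edist (e x) (e x')

theorem dist_le_of_edist_comap_le {S : Set A} (e : Option α ≃ A) {x x' : Option α} {n : ℕ}
    (h : ((SimpleGraph.mulCayley S).comap e).edist x x' ≤ n) :
    (SimpleGraph.mulCayley S).dist (e x) (e x') ≤ n := by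
  have he : EdgeLipschitz ((SimpleGraph.mulCayley S).comap e) (SimpleGraph.mulCayley S) e 1 :=
    fun a a' haa => (SimpleGraph.edist_eq_one_iff_adj.2 (SimpleGraph.comap_adj.1 haa)).le
  exact ENat.toNat_le_of_le_natCast ((he.edist_le_edist x x').trans h)

theorem connected_comap {S : Set A} (hS : (SimpleGraph.mulCayley S).Connected)
    (e : Option α ≃ A) : ((SimpleGraph.mulCayley S).comap e).Connected :=
  (SimpleGraph.Iso.comap e (SimpleGraph.mulCayley S)).connected_iff.2 hS

/-- If the nontrivial elements of two groups are related by a coarse bijection then the free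
products of the groups with a third group are bilipschitz equivalent. -/
theorem bilipschitzEquivalent_coprod_of_relation
    {S : Set A} {T : Set B} {U : Set C} (hS : S.Finite) (hT : T.Finite)
    (hSc : (SimpleGraph.mulCayley S).Connected) (hTc : (SimpleGraph.mulCayley T).Connected)
    (hUc : (SimpleGraph.mulCayley U).Connected)
    {eA : Option α ≃ A} {eB : Option β ≃ B} {eC : Option γ ≃ C}
    (hA : eA none = 1) (hB : eB none = 1) (hC : eC none = 1)
    [Nontrivial (γ × α)] [Nontrivial (γ × β)]
    {p : Y → α} {q : Y → β} (hp : Function.Surjective p) (hq : Function.Surjective q)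
    (hpq : ∀ y y', p y = p y' → q y = q y' → y = y')
    {K : ℕ}
    (hK : ∀ y y' : Option Y, (SimpleGraph.mulCayley S).dist (eA (y.map p)) (eA (y'.map p)) ≤ 1 →
      (SimpleGraph.mulCayley T).dist (eB (y.map q)) (eB (y'.map q)) ≤ K)
    (hK' : ∀ y y' : Option Y, (SimpleGraph.mulCayley T).dist (eB (y.map q)) (eB (y'.map q)) ≤ 1 →
      (SimpleGraph.mulCayley S).dist (eA (y.map p)) (eA (y'.map p)) ≤ K) :
    BilipschitzEquivalent
      (SimpleGraph.mulCayley
        (Monoid.Coprod.inl '' S ∪ Monoid.Coprod.inr '' U : Set (Monoid.Coprod A C)))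
      (SimpleGraph.mulCayley
        (Monoid.Coprod.inl '' T ∪ Monoid.Coprod.inr '' U : Set (Monoid.Coprod B C))) := by
  -- A fibre of one projection is embedded by the other, with diameter at most `K`.
  obtain ⟨σ, N, rfl, hN⟩ := exists_splitting_of_dist_le (K := K) hT hTc p hp
    (fun y => eB (some (q y)))
    (fun y y' h h' => hpq y y' h (Option.some_injective _ (eB.injective h')))
    (fun y y' h => hK (some y) (some y') (by simp [h]))
  obtain ⟨τ, N', rfl, hN'⟩ := exists_splitting_of_dist_le (K := K) hS hSc q hq
    (fun y => eA (some (σ.p y)))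
    (fun y y' h h' => hpq y y' (Option.some_injective _ (eA.injective h')) h)
    (fun y y' h => hK' (some y) (some y') (by simp [h]))
  have h₁ := (bilipschitzEquivalent_mulCayley_coprod hA hC S U).symm
  have h₂ := (σ.bilipschitzEquivalent_coverGraph (connected_comap hSc eA) (connected_comap hUc eC)
    hN).symm
  have h₃ := τ.bilipschitzEquivalent_coverGraph (connected_comap hTc eB) (connected_comap hUc eC)
    hN'
  have h₄ := bilipschitzEquivalent_mulCayley_coprod hB hC T U
  -- What remains compares two trees on the same vertex set, built from the metrics pulled back to
  -- `Y` from `A` and from `B`.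
  refine h₁.trans (h₂.trans (BilipschitzEquivalent.trans ?_ (h₃.trans h₄)))
  refine ⟨Equiv.refl _, 1 + K + 1, edgeLipschitz_treeGraph_id (edgeLipschitz_coverGraph_id σ.p τ
    fun y y' h => ?_) (by omega), edgeLipschitz_treeGraph_id (edgeLipschitz_coverGraph_id τ.p σ
    fun y y' h => ?_) (by omega)⟩
  · refine (edist_comap_le_dist hTc eB _ _).trans ?_
    exact_mod_cast hK y y' (dist_le_of_edist_comap_le eA (by exact_mod_cast h))
  · refine (edist_comap_le_dist hSc eA _ _).trans ?_
    exact_mod_cast hK' y y' (dist_le_of_edist_comap_le eB (by exact_mod_cast h))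

theorem card_eq_two_of_subsingleton {G : Type*} [Group G] [Nontrivial G]
    (h : Subsingleton {g : G // g ≠ 1}) : Nat.card G = 2 := by
  classical
  obtain ⟨g, hg⟩ := exists_ne (1 : G)
  rw [← Nat.card_congr (Equiv.optionSubtypeNe (1 : G)), Finite.card_option,
    Nat.card_eq_one_iff_unique.2 ⟨h, ⟨⟨g, hg⟩⟩⟩]

theorem nontrivial_prod_ne_one [Nontrivial A] [Nontrivial C]
    (h : ¬ (Nat.card C = 2 ∧ Nat.card A = 2)) :
    Nontrivial ({c : C // c ≠ 1} × {a : A // a ≠ 1}) := by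
  obtain ⟨a₀, ha₀⟩ := exists_ne (1 : A)
  obtain ⟨c₀, hc₀⟩ := exists_ne (1 : C)
  let a₁ : {a : A // a ≠ 1} := ⟨a₀, ha₀⟩
  let c₁ : {c : C // c ≠ 1} := ⟨c₀, hc₀⟩
  by_contra hn
  rw [not_nontrivial_iff_subsingleton] at hn
  exact h ⟨card_eq_two_of_subsingleton
      ⟨fun c c' => congrArg Prod.fst (Subsingleton.elim (c, a₁) (c', a₁))⟩,
    card_eq_two_of_subsingleton
      ⟨fun a a' => congrArg Prod.snd (Subsingleton.elim (c₁, a) (c₁, a'))⟩⟩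

end Relation

/-! ### From a quasi-isometry to a coarse relation. -/

section QuasiIsometry

variable {A B : Type*} [Group A] [Group B]

open Classical in
/-- A quasi-isometry of groups induces a coarse bijection of their nontrivial elements. -/
theorem exists_relation_of_isGraphQuasiIsometry [Nontrivial A] [Nontrivial B]
    {S : Set A} {T : Set B} (hT : (SimpleGraph.mulCayley T).Connected) {f : A → B}
    (hf : IsGraphQuasiIsometry (SimpleGraph.mulCayley S) (SimpleGraph.mulCayley T) f) :
    ∃ (r : Set ({a : A // a ≠ 1} × {b : B // b ≠ 1})) (K : ℕ),
      (∀ a, ∃ b, (a, b) ∈ r) ∧ (∀ b, ∃ a, (a, b) ∈ r) ∧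
      ∀ y y' : Option r,
        ((SimpleGraph.mulCayley S).dist (Equiv.optionSubtypeNe 1 (y.map (·.1.1)))
            (Equiv.optionSubtypeNe 1 (y'.map (·.1.1))) ≤ 1 →
          (SimpleGraph.mulCayley T).dist (Equiv.optionSubtypeNe 1 (y.map (·.1.2)))
            (Equiv.optionSubtypeNe 1 (y'.map (·.1.2))) ≤ K) ∧
        ((SimpleGraph.mulCayley T).dist (Equiv.optionSubtypeNe 1 (y.map (·.1.2)))
            (Equiv.optionSubtypeNe 1 (y'.map (·.1.2))) ≤ 1 →
          (SimpleGraph.mulCayley S).dist (Equiv.optionSubtypeNe 1 (y.map (·.1.1)))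
            (Equiv.optionSubtypeNe 1 (y'.map (·.1.1))) ≤ K) := by
  obtain ⟨L, c, hL, hc, hLc, hsurj⟩ := hf
  obtain ⟨a₀, ha₀⟩ := exists_ne (1 : A)
  obtain ⟨b₀, hb₀⟩ := exists_ne (1 : B)
  set d := (SimpleGraph.mulCayley S).dist
  set d' := (SimpleGraph.mulCayley T).dist
  have htri : ∀ x y z, (d' x z : ℝ) ≤ d' x y + d' y z := fun x y z => by
    exact_mod_cast hT.dist_triangle
  have hcomm : ∀ x y, d' x y = d' y x := fun x y => SimpleGraph.dist_comm
  have hself : ∀ x, (d' x x : ℝ) = 0 := fun x => by simp [d']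
  have hpos : ∀ x y, (0 : ℝ) ≤ d' x y := fun x y => Nat.cast_nonneg _
  -- The relation is `d' (f a) b ≤ M`. The bounds serve in turn to relate `a` to `b₀` when `f a =
  -- 1`, to relate `a₀` to `b` when the point found with image near `b` is `1`, and to let the
  -- identities count as related.
  obtain ⟨M, h₀, h₁, h₂⟩ : ∃ M : ℝ, d' 1 b₀ ≤ M ∧ d' (f a₀) (f 1) + c ≤ M ∧ d' (f 1) 1 ≤ M := by
    refine ⟨d' 1 b₀ + (d' (f a₀) (f 1) + c) + d' (f 1) 1, ?_, ?_, ?_⟩ <;>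
      linarith [hpos 1 b₀, hpos (f a₀) (f 1), hpos (f 1) 1]
  have hM : 0 ≤ M := le_trans (Nat.cast_nonneg _) h₀
  have near : ∀ y : Option {y : {a : A // a ≠ 1} × {b : B // b ≠ 1} | (d' (f y.1) y.2 : ℝ) ≤ M},
      (d' (f (Equiv.optionSubtypeNe 1 (y.map (·.1.1))))
        (Equiv.optionSubtypeNe 1 (y.map (·.1.2))) : ℝ) ≤ M := by
    rintro (_ | y)
    · simpa using h₂
    · exact y.2
  -- One step, plus an error `M` at each end, distorted by `L` and `c`; since `1 ≤ L`, this
  -- dominates the bound `L + c + 2 * M` of the other direction.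
  obtain ⟨K, hK⟩ := exists_nat_ge (L * (1 + 2 * M + c))
  refine ⟨{y | (d' (f y.1) y.2 : ℝ) ≤ M}, K, fun a => ?_, fun b => ?_, fun y y' => ?_⟩
  · by_cases h : f a = 1
    · exact ⟨⟨b₀, hb₀⟩, by simpa [h] using h₀⟩
    · exact ⟨⟨f a, h⟩, by simpa [hself] using hM⟩
  · obtain ⟨a, ha⟩ := hsurj b
    by_cases h : a = 1
    · subst h
      exact ⟨⟨a₀, ha₀⟩, (htri (f a₀) (f 1) b).trans (by linarith)⟩
    · refine ⟨⟨a, h⟩, ?_⟩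
      simp only [Set.mem_ofPred_eq]
      linarith [hpos (f a₀) (f 1)]
  · have hy := near y
    have hy' := near y'
    generalize Equiv.optionSubtypeNe 1 (y.map (·.1.1)) = a at *
    generalize Equiv.optionSubtypeNe 1 (y'.map (·.1.1)) = a' at *
    generalize Equiv.optionSubtypeNe 1 (y.map (·.1.2)) = b at *
    generalize Equiv.optionSubtypeNe 1 (y'.map (·.1.2)) = b' at *
    obtain ⟨h₃, h₄⟩ := hLc a a'
    refine ⟨fun h => ?_, fun h => ?_⟩
    · have hR : (d a a' : ℝ) ≤ 1 := by exact_mod_cast h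
      have t₁ := htri b (f a) b'
      have t₂ := htri (f a) (f a') b'
      rw [hcomm b (f a)] at t₁
      have : (d' b b' : ℝ) ≤ K := by nlinarith
      exact_mod_cast this
    · have hR : (d' b b' : ℝ) ≤ 1 := by exact_mod_cast h
      have t₁ := htri (f a) b (f a')
      have t₂ := htri b b' (f a')
      rw [hcomm b' (f a')] at t₂
      have h₅ : L⁻¹ * (d a a' : ℝ) ≤ 1 + 2 * M + c := by linarith
      rw [inv_mul_le_iff₀ (by linarith)] at h₅
      have : (d a a' : ℝ) ≤ K := h₅.trans hK
      exact_mod_cast this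

end QuasiIsometry

end FreeProductTree

open FreeProductTree in
theorem theorem1 {A B C : Type*} [Group A] [Group B] [Group C]
    [Group.FG A] [Group.FG B] [Group.FG C]
    [Nontrivial A] [Nontrivial B] [Nontrivial C]
    (hAB : GroupsQuasiIsometric A B)
    (hord : ¬ (Nat.card C = 2 ∧ (Nat.card A = 2 ∨ Nat.card B = 2))) :
    GroupsQuasiIsometric (Monoid.Coprod A C) (Monoid.Coprod B C) := by
  classical
  obtain ⟨S, T, hS, hS', hT, hT', f, hf⟩ := hAB
  obtain ⟨U, hU', hU⟩ := Group.fg_iff.1 ‹Group.FG C›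
  have hSc := mulCayley_connected_of_closure_eq_top S hS'
  have hTc := mulCayley_connected_of_closure_eq_top T hT'
  have hUc := mulCayley_connected_of_closure_eq_top U hU'
  have := nontrivial_prod_ne_one (A := A) (C := C) fun h => hord ⟨h.1, Or.inl h.2⟩
  have := nontrivial_prod_ne_one (A := B) (C := C) fun h => hord ⟨h.1, Or.inr h.2⟩
  obtain ⟨r, K, hr, hr', hK⟩ := exists_relation_of_isGraphQuasiIsometry hTc hf
  refine ⟨_, _, (hS.image _).union (hU.image _), closure_inl_union_inr hS' hU',
    (hT.image _).union (hU.image _), closure_inl_union_inr hT' hU', ?_⟩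
  refine BilipschitzEquivalent.exists_isGraphQuasiIsometry
    (mulCayley_connected_of_closure_eq_top _ (closure_inl_union_inr hS' hU'))
    (mulCayley_connected_of_closure_eq_top _ (closure_inl_union_inr hT' hU')) ?_
  exact bilipschitzEquivalent_coprod_of_relation (Y := r) (p := (·.1.1)) (q := (·.1.2))
    (eC := Equiv.optionSubtypeNe 1) hS hT hSc hTc hUc
    (Equiv.optionSubtypeNe_none 1) (Equiv.optionSubtypeNe_none 1) (Equiv.optionSubtypeNe_none 1)
    (fun a => let ⟨b, hb⟩ := hr a; ⟨⟨(a, b), hb⟩, rfl⟩)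
    (fun b => let ⟨a, ha⟩ := hr' b; ⟨⟨(a, b), ha⟩, rfl⟩)
    (fun _ _ h h' => Subtype.ext (Prod.ext h h')) (fun y y' => (hK y y').1) (fun y y' => (hK y y').2)
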